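/- Let $X$ be a complex Banach space, let $k\ge 1$ be an integer and $n=2k+1$. For an integrable function $F:\mathbb R^n\to X$ put $$\hat F(\xi)=\int_{\mathbb R^n}e^{-i\xi\cdot s}F(s)\,ds,\qquad S_R(F)(x)=\frac1{(2\pi)^n}\int_{|\xi|\le R}e^{ix\cdot\xi}\hat F(\xi)\,d\xi ,$$ and, when $F$ is also continuous, let $$\bar F_x(r)=\frac1{\omega_{n-1}}\int_{\mathbb S^{n-1}}F(x+r\omega)\,d\omega\qquad(x\in\mathbb R^n,\ r\ge 0)$$ be the spherical mean of $F$ about $x$, where $\mathbb S^{n-1}$ is the unit sphere of $\mathbb R^n$, $d\omega$ its surface measure and $\omega_{n-1}$ its total surface area. Let $K\subset\mathbb R^n$ be compact, and let $F:\mathbb R^n\to X$ be integrable and $k$ times continuously differentiable. Suppose that for some $\delta>0$ the set $$\Big\{\,r\mapsto \frac{\bar F_x(r)-\mathbf 1_{(0,\delta)}(r)F(x)}{r}\;:\;x\in K\Big\}$$ is a compact subset of $L^1((0,\infty);X)$, and that for each $j=1,\dots,k$ the set $$\Big\{\,r\mapsto r^{\,j-1}\Big(\frac{d}{dr}\Big)^{l}\bar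 F_x(r)\;:\;x\in K,\ l=0,\dots,j\Big\}$$ is a compact subset of $L^1((0,\infty);X)$. Then Fourier inversion holds uniformly on $K$, that is, $$\lim_{R\to\infty}\ \sup_{x\in K}\ \|S_R(F)(x)-F(x)\|_X=0 .$$ -/

import Mathlib

open MeasureTheory Set Filter Topology

noncomputable section

/-- The surface measure on the unit sphere of `ℝⁿ`. -/
def sphereMeasure (n : ℕ) :
    Measure (Metric.sphere (0 : EuclideanSpace ℝ (Fin n)) 1) :=
  (volume : Measure (EuclideanSpace ℝ (Fin n))).toSphere

/-- The spherical mean `r ↦ ω_{n-1}⁻¹ ∫_{𝕊^{n-1}} F (x + r ω) dω` of `F` about `x`. -/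
def sphericalMean {X : Type*} [NormedAddCommGroup X] [NormedSpace ℂ X] {n : ℕ}
    (F : EuclideanSpace ℝ (Fin n) → X) (x : EuclideanSpace ℝ (Fin n)) (r : ℝ) : X :=
  ((sphereMeasure n).real univ)⁻¹ •
    ∫ w, F (x + r • (w : EuclideanSpace ℝ (Fin n))) ∂(sphereMeasure n)

/-- The Fourier transform `ξ ↦ ∫ e^{-i ξ·s} F(s) ds`. -/
def fourierHat {X : Type*} [NormedAddCommGroup X] [NormedSpace ℂ X] {n : ℕ}
    (F : EuclideanSpace ℝ (Fin n) → X) (ξ : EuclideanSpace ℝ (Fin n)) : X :=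
  ∫ s, Complex.exp (-(Complex.I * ((inner ℝ ξ s : ℝ) : ℂ))) • F s

/-- The truncated inversion integral
`S_R(F)(x) = (2π)⁻ⁿ ∫_{|ξ| ≤ R} e^{i x·ξ} (fourierHat F)(ξ) dξ`. -/
def fourierPartial {X : Type*} [NormedAddCommGroup X] [NormedSpace ℂ X] {n : ℕ}
    (R : ℝ) (F : EuclideanSpace ℝ (Fin n) → X) (x : EuclideanSpace ℝ (Fin n)) : X :=
  (((2 * Real.pi) ^ n)⁻¹ : ℝ) •
    ∫ ξ in Metric.closedBall (0 : EuclideanSpace ℝ (Fin n)) R,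
      Complex.exp (Complex.I * ((inner ℝ x ξ : ℝ) : ℂ)) • fourierHat F ξ

/-- Fourier inversion holds uniformly on `K`: `S_R(F) → F` uniformly on `K` as `R → ∞`. -/
def FourierInversionUniformlyOn {X : Type*} [NormedAddCommGroup X] [NormedSpace ℂ X] {n : ℕ}
    (F : EuclideanSpace ℝ (Fin n) → X) (K : Set (EuclideanSpace ℝ (Fin n))) : Prop :=
  TendstoUniformlyOn (fun R : ℝ => fourierPartial R F) F atTop K

/-- A set `S` of functions `ℝ → X`, restricted to `(0,∞)`, is a compact subset of
`L¹((0,∞);X)`: every member is integrable there, and the set of the corresponding classes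
is compact for the `L¹` norm. -/
def IsCompactInL1 {X : Type*} [NormedAddCommGroup X] [NormedSpace ℂ X]
    (S : Set (ℝ → X)) : Prop :=
  (∀ g ∈ S, IntegrableOn g (Ioi 0)) ∧
    IsCompact {f : Lp X 1 ((volume : Measure ℝ).restrict (Ioi 0)) |
      ∃ g ∈ S, (f : ℝ → X) =ᵐ[(volume : Measure ℝ).restrict (Ioi 0)] g}

end

/-! By Fubini, `fourierPartial R F x` is the convolution of `F` with the Fourier transform of a
ball. In dimension `2k+1` slicing makes this transform a constant times `ballKernel R k ‖y‖`, so in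
polar coordinates everything reduces to `∫ r^(2k) A_k(r) f(r) dr`, with `f` the spherical mean about
`x` and `A_p = ballKernel R p` (`fourierPartial_eq_integral_sphericalMean`).

Since `r A_{p+1} = -2(p+1) A_p'`, one integration by parts lowers `p` by one at the cost of one
derivative of `f`. After `k` of them (`exists_integral_ballKernel_smul_eq`) the kernel is `A_0 = 2
sin(Rr)/r` and `f` has become `∑ c_j r^j f^(j)`, where `c_0 = (2k)!`. Boundary terms at infinity
vanish because the integrability hypotheses force `r^(k-1) f^(l) → 0` for `l < k`.

The terms `j ≥ 1` are sine integrals of `r^(j-1) f^(j)`, and tend to `0` uniformly on `K` by the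
Riemann–Lebesgue lemma on compact subsets of `L¹`. So does the part of `f/r` left after subtracting
`F x / r` on `(0, δ)`. The subtracted part is a Dirichlet integral tending to `π/2`, and
`inversion_constant` makes its total contribution `F x`. -/

/-! ### Recurrences and decay of the ball kernel. -/

/-- The one-dimensional integral `∫_{-R}^R (R² - t²)^p cos (t r) dt`; up to a constant it is the
Fourier transform of the indicator of a ball in dimension `2 p + 1`. -/
noncomputable def ballKernel (R : ℝ) (p : ℕ) (r : ℝ) : ℝ :=
  ∫ t in -R..R, (R ^ 2 - t ^ 2) ^ p * Real.cos (t * r)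

/-- Minus the derivative of `ballKernel R p`. -/
noncomputable def ballKernelAux (R : ℝ) (p : ℕ) (r : ℝ) : ℝ :=
  ∫ t in -R..R, t * (R ^ 2 - t ^ 2) ^ p * Real.sin (t * r)

theorem hasDerivAt_ballKernel (R : ℝ) (p : ℕ) (r : ℝ) :
    HasDerivAt (ballKernel R p) (-ballKernelAux R p r) r := by
  have h := (intervalIntegral.hasDerivAt_integral_of_dominated_loc_of_deriv_le
    (μ := volume) (a := -R) (b := R) (F := fun r t => (R ^ 2 - t ^ 2) ^ p * Real.cos (t * r))
    (F' := fun r t => (R ^ 2 - t ^ 2) ^ p * (-Real.sin (t * r) * t)) (x₀ := r) (s := univ)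
    (bound := fun t => |R ^ 2 - t ^ 2| ^ p * |t|) univ_mem
    (Eventually.of_forall fun x => (Continuous.aestronglyMeasurable (by fun_prop)))
    (Continuous.intervalIntegrable (by fun_prop) _ _)
    (Continuous.aestronglyMeasurable (by fun_prop))
    (Eventually.of_forall fun t _ x _ => by
      rw [norm_mul, norm_mul, norm_neg, norm_pow, Real.norm_eq_abs, Real.norm_eq_abs,
        Real.norm_eq_abs]
      gcongr
      exact mul_le_of_le_one_left (abs_nonneg _) (Real.abs_sin_le_one _))
    (Continuous.intervalIntegrable (by fun_prop) _ _)
    (Eventually.of_forall fun t _ x _ => by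
      have h1 : HasDerivAt (fun x : ℝ => t * x) t x := by
        simpa using (hasDerivAt_id x).const_mul t
      exact h1.cos.const_mul _)).2
  convert! h using 1
  rw [ballKernelAux, ← intervalIntegral.integral_neg]
  congr 1
  ext t
  ring

theorem continuous_ballKernel (R : ℝ) (p : ℕ) : Continuous (ballKernel R p) :=
  continuous_iff_continuousAt.2 fun r => (hasDerivAt_ballKernel R p r).continuousAt

theorem mul_ballKernel_zero (R r : ℝ) : r * ballKernel R 0 r = 2 * Real.sin (R * r) := by
  have h : ∀ t ∈ uIcc (-R) R, HasDerivAt (fun t => Real.sin (t * r)) (Real.cos (t * r) * r) t :=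
    fun t _ => by simpa using ((hasDerivAt_id t).mul_const r).sin
  have := intervalIntegral.integral_eq_sub_of_hasDerivAt h
    (Continuous.intervalIntegrable (by fun_prop) _ _)
  rw [intervalIntegral.integral_mul_const] at this
  simp only [ballKernel, pow_zero, one_mul]
  rw [mul_comm, this, neg_mul, Real.sin_neg]
  ring

theorem hasDerivAt_sq_sub_sq_pow_succ (R : ℝ) (p : ℕ) (t : ℝ) :
    HasDerivAt (fun t => (R ^ 2 - t ^ 2) ^ (p + 1))
      ((p + 1) * (R ^ 2 - t ^ 2) ^ p * (-(2 * t))) t := by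
  simpa using (((hasDerivAt_id t).fun_pow 2).const_sub (R ^ 2)).fun_pow (p + 1)

/-- Integrate the derivative of `(R² - t²)^(p+1) sin(tr)`, which vanishes at `±R`. As
`ballKernelAux` is minus the derivative of the kernel, this is the relation that drives the later
integration by parts. -/
theorem mul_ballKernel_succ (R : ℝ) (p : ℕ) (r : ℝ) :
    r * ballKernel R (p + 1) r = 2 * (p + 1) * ballKernelAux R p r := by
  have h : ∀ t ∈ uIcc (-R) R, HasDerivAt (fun t => (R ^ 2 - t ^ 2) ^ (p + 1) * Real.sin (t * r))
      (r * ((R ^ 2 - t ^ 2) ^ (p + 1) * Real.cos (t * r)) -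
        2 * (p + 1) * (t * (R ^ 2 - t ^ 2) ^ p * Real.sin (t * r))) t := fun t _ => by
    have h1 : HasDerivAt (fun t => Real.sin (t * r)) (Real.cos (t * r) * r) t := by
      simpa using ((hasDerivAt_id t).mul_const r).sin
    have h2 := hasDerivAt_sq_sub_sq_pow_succ R p t
    convert! h2.mul h1 using 1
    ring
  have := intervalIntegral.integral_eq_sub_of_hasDerivAt h
    (Continuous.intervalIntegrable (by fun_prop) _ _)
  rw [intervalIntegral.integral_sub (Continuous.intervalIntegrable (by fun_prop) _ _)
    (Continuous.intervalIntegrable (by fun_prop) _ _), intervalIntegral.integral_const_mul,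
    intervalIntegral.integral_const_mul] at this
  simp only [neg_sq, sub_self, zero_pow p.succ_ne_zero, zero_mul] at this
  exact sub_eq_zero.1 this

theorem mul_ballKernelAux_zero (R r : ℝ) :
    r * ballKernelAux R 0 r = ballKernel R 0 r - 2 * R * Real.cos (R * r) := by
  have h : ∀ t ∈ uIcc (-R) R, HasDerivAt (fun t => t * Real.cos (t * r))
      (Real.cos (t * r) - r * (t * Real.sin (t * r))) t := fun t _ => by
    have h1 : HasDerivAt (fun t => Real.cos (t * r)) (-Real.sin (t * r) * r) t := by
      simpa using ((hasDerivAt_id t).mul_const r).cos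
    convert! (hasDerivAt_id t).mul h1 using 1
    simp only [id]
    ring
  have := intervalIntegral.integral_eq_sub_of_hasDerivAt h
    (Continuous.intervalIntegrable (by fun_prop) _ _)
  rw [intervalIntegral.integral_sub (Continuous.intervalIntegrable (by fun_prop) _ _)
    (Continuous.intervalIntegrable (by fun_prop) _ _), intervalIntegral.integral_const_mul] at this
  simp only [neg_mul, Real.cos_neg] at this
  simp only [ballKernel, ballKernelAux, pow_zero, one_mul, mul_one]
  linarith

/-- Differentiate `t (R² - t²)^(p+1) cos(tr)` and write `t² = R² - (R² - t²)`; hence `2p + 3 = 1 +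
2(p+1)`. -/
theorem mul_ballKernelAux_succ (R : ℝ) (p : ℕ) (r : ℝ) :
    r * ballKernelAux R (p + 1) r =
      (2 * p + 3) * ballKernel R (p + 1) r - 2 * (p + 1) * R ^ 2 * ballKernel R p r := by
  have h : ∀ t ∈ uIcc (-R) R,
      HasDerivAt (fun t => t * (R ^ 2 - t ^ 2) ^ (p + 1) * Real.cos (t * r))
      (((2 * p + 3) * ((R ^ 2 - t ^ 2) ^ (p + 1) * Real.cos (t * r)) -
        2 * (p + 1) * R ^ 2 * ((R ^ 2 - t ^ 2) ^ p * Real.cos (t * r))) -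
        r * (t * (R ^ 2 - t ^ 2) ^ (p + 1) * Real.sin (t * r))) t := fun t _ => by
    have h1 : HasDerivAt (fun t => Real.cos (t * r)) (-Real.sin (t * r) * r) t := by
      simpa using ((hasDerivAt_id t).mul_const r).cos
    have h2 := hasDerivAt_sq_sub_sq_pow_succ R p t
    convert! ((hasDerivAt_id t).mul h2).mul h1 using 1
    simp only [id, Pi.mul_apply]
    ring
  have := intervalIntegral.integral_eq_sub_of_hasDerivAt h
    (Continuous.intervalIntegrable (by fun_prop) _ _)
  rw [intervalIntegral.integral_sub (Continuous.intervalIntegrable (by fun_prop) _ _)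
    (Continuous.intervalIntegrable (by fun_prop) _ _),
    intervalIntegral.integral_sub (Continuous.intervalIntegrable (by fun_prop) _ _)
    (Continuous.intervalIntegrable (by fun_prop) _ _), intervalIntegral.integral_const_mul,
    intervalIntegral.integral_const_mul, intervalIntegral.integral_const_mul] at this
  simp only [neg_sq, sub_self, zero_pow p.succ_ne_zero, zero_mul, mul_zero] at this
  exact (sub_eq_zero.1 this).symm

/-- Each recurrence gains a factor `1/r`; kernel and derivative must be bounded together because the
recurrences couple them. The dependence of `C` on `R` is harmless: the bound only kills boundary
terms at fixed `R`. -/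
theorem exists_abs_ballKernel_le (R : ℝ) (p : ℕ) : ∃ C, 0 ≤ C ∧ ∀ r : ℝ, 1 ≤ r →
    r ^ (p + 1) * |ballKernel R p r| ≤ C ∧ r ^ (p + 1) * |ballKernelAux R p r| ≤ C := by
  induction p with
  | zero =>
    refine ⟨2 + 2 * |R|, by positivity, fun r hr => ?_⟩
    have h0 : 0 < r := by linarith
    have hA : r * |ballKernel R 0 r| ≤ 2 := by
      rw [← abs_of_pos h0, ← abs_mul, abs_of_pos h0, mul_ballKernel_zero, abs_mul, abs_two]
      linarith [Real.abs_sin_le_one (R * r)]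
    have hA' : |ballKernel R 0 r| ≤ 2 :=
      (le_mul_of_one_le_left (abs_nonneg _) hr).trans hA
    have hB : r * |ballKernelAux R 0 r| ≤ 2 + 2 * |R| := by
      rw [← abs_of_pos h0, ← abs_mul, abs_of_pos h0, mul_ballKernelAux_zero]
      refine (abs_sub _ _).trans ?_
      rw [abs_mul, abs_mul, abs_two]
      have := mul_le_of_le_one_right (abs_nonneg R) (Real.abs_cos_le_one (R * r))
      linarith
    simp only [zero_add, pow_one]
    exact ⟨by linarith [abs_nonneg R], hB⟩
  | succ p ih =>
    obtain ⟨C, hC, h⟩ := ih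
    refine ⟨(2 * p + 3) * (2 * (p + 1) * C) + 2 * (p + 1) * R ^ 2 * C + 2 * (p + 1) * C,
      by positivity, fun r hr => ?_⟩
    have h0 : 0 < r := by linarith
    obtain ⟨h1, h2⟩ := h r hr
    have hA : r ^ (p + 1 + 1) * |ballKernel R (p + 1) r| ≤ 2 * (p + 1) * C := by
      have : r * |ballKernel R (p + 1) r| = 2 * (p + 1) * |ballKernelAux R p r| := by
        rw [← abs_of_pos h0, ← abs_mul, abs_of_pos h0, mul_ballKernel_succ, abs_mul,
          abs_of_nonneg (by positivity : (0 : ℝ) ≤ 2 * (p + 1))]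
      rw [pow_succ, mul_assoc, this]
      calc _ = 2 * (p + 1) * (r ^ (p + 1) * |ballKernelAux R p r|) := by ring
        _ ≤ _ := by gcongr
    have hA' : r ^ (p + 1) * |ballKernel R (p + 1) r| ≤ 2 * (p + 1) * C := by
      refine le_trans ?_ hA
      gcongr
      omega
    have hB : r ^ (p + 1 + 1) * |ballKernelAux R (p + 1) r| ≤
        (2 * p + 3) * (2 * (p + 1) * C) + 2 * (p + 1) * R ^ 2 * C := by
      have : r * |ballKernelAux R (p + 1) r| ≤
          (2 * p + 3) * |ballKernel R (p + 1) r| + 2 * (p + 1) * R ^ 2 * |ballKernel R p r| := by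
        rw [← abs_of_pos h0, ← abs_mul, abs_of_pos h0, mul_ballKernelAux_succ]
        refine (abs_sub _ _).trans ?_
        rw [abs_mul, abs_mul, abs_of_nonneg (by positivity : (0 : ℝ) ≤ 2 * p + 3),
          abs_of_nonneg (by positivity : (0 : ℝ) ≤ 2 * (p + 1) * R ^ 2)]
      rw [pow_succ, mul_assoc]
      calc _ ≤ r ^ (p + 1) * ((2 * p + 3) * |ballKernel R (p + 1) r|
              + 2 * (p + 1) * R ^ 2 * |ballKernel R p r|) := by gcongr
        _ = (2 * p + 3) * (r ^ (p + 1) * |ballKernel R (p + 1) r|)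
              + 2 * (p + 1) * R ^ 2 * (r ^ (p + 1) * |ballKernel R p r|) := by ring
        _ ≤ _ := by gcongr
    refine ⟨hA.trans ?_, hB.trans ?_⟩
    · exact le_add_of_nonneg_left (by positivity)
    · exact le_add_of_nonneg_right (by positivity)

/-! ### Fourier transform of the ball in odd dimension. -/

/-- Splitting off the first coordinate of a point of `ℝ^{m+1}`. -/
noncomputable def euclideanFinSuccEquiv (m : ℕ) :
    EuclideanSpace ℝ (Fin (m + 1)) ≃ᵐ ℝ × EuclideanSpace ℝ (Fin m) :=
  ((MeasurableEquiv.toLp 2 (Fin (m + 1) → ℝ)).symm.trans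
    (MeasurableEquiv.piFinSuccAbove (fun _ => ℝ) 0)).trans
    ((MeasurableEquiv.refl ℝ).prodCongr (MeasurableEquiv.toLp 2 (Fin m → ℝ)))

theorem euclideanFinSuccEquiv_fst {m : ℕ} (ξ : EuclideanSpace ℝ (Fin (m + 1))) :
    (euclideanFinSuccEquiv m ξ).1 = ξ 0 := rfl

theorem euclideanFinSuccEquiv_snd {m : ℕ} (ξ : EuclideanSpace ℝ (Fin (m + 1))) (i : Fin m) :
    (euclideanFinSuccEquiv m ξ).2 i = ξ i.succ := rfl

theorem measurePreserving_euclideanFinSuccEquiv (m : ℕ) :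
    MeasurePreserving (euclideanFinSuccEquiv m) volume volume :=
  ((MeasurePreserving.id volume).prod (PiLp.volume_preserving_toLp (Fin m))).comp
    ((volume_preserving_piFinSuccAbove (fun _ => ℝ) 0).comp
      (PiLp.volume_preserving_ofLp (Fin (m + 1))))

theorem mem_closedBall_iff_euclideanFinSuccEquiv {m : ℕ} {R : ℝ} (hR : 0 ≤ R)
    (ξ : EuclideanSpace ℝ (Fin (m + 1))) :
    ξ ∈ Metric.closedBall 0 R ↔
      ‖(euclideanFinSuccEquiv m ξ).2‖ ^ 2 ≤ R ^ 2 - (euclideanFinSuccEquiv m ξ).1 ^ 2 := by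
  rw [mem_closedBall_zero_iff, ← sq_le_sq₀ (norm_nonneg _) hR, EuclideanSpace.norm_sq_eq,
    EuclideanSpace.norm_sq_eq, Fin.sum_univ_succ, le_sub_iff_add_le']
  simp only [euclideanFinSuccEquiv_fst, euclideanFinSuccEquiv_snd, Real.norm_eq_abs, sq_abs]

/-- Integration over a ball of a function of the first coordinate, by slices. -/
theorem integral_closedBall_first_coord {k : ℕ} (hk : 1 ≤ k) {R : ℝ} (hR : 0 ≤ R) {g : ℝ → ℂ}
    (hg : Continuous g) :
    ∫ ξ in Metric.closedBall (0 : EuclideanSpace ℝ (Fin (2 * k + 1))) R, g (ξ 0) =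
      ((Real.pi ^ k / k.factorial : ℝ) : ℂ) *
        ∫ t in -R..R, (((R ^ 2 - t ^ 2) ^ k : ℝ) : ℂ) * g t := by
  classical
  set S : Set (ℝ × EuclideanSpace ℝ (Fin (2 * k))) := {p | ‖p.2‖ ^ 2 ≤ R ^ 2 - p.1 ^ 2} with hS
  have hSm : MeasurableSet S := measurableSet_le (by fun_prop) (by fun_prop)
  have hind : ∀ ξ : EuclideanSpace ℝ (Fin (2 * k + 1)),
      (Metric.closedBall 0 R).indicator (fun ξ => g (ξ 0)) ξ =
        S.indicator (fun p => g p.1) (euclideanFinSuccEquiv (2 * k) ξ) := fun ξ => by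
    simp only [indicator_apply, mem_closedBall_iff_euclideanFinSuccEquiv hR, hS,
      mem_ofPred_eq, euclideanFinSuccEquiv_fst]
    rfl
  have hmp := measurePreserving_euclideanFinSuccEquiv (2 * k)
  have hint : Integrable (S.indicator (fun p => g p.1)) := by
    rw [← hmp.integrable_comp_emb (MeasurableEquiv.measurableEmbedding _)]
    refine Integrable.congr (f := (Metric.closedBall 0 R).indicator (fun ξ => g (ξ 0))) ?_
      (Eventually.of_forall hind)
    rw [integrable_indicator_iff Metric.isClosed_closedBall.measurableSet]
    exact ContinuousOn.integrableOn_compact (isCompact_closedBall _ _) (by fun_prop)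
  rw [← integral_indicator Metric.isClosed_closedBall.measurableSet, funext hind,
    hmp.integral_comp (MeasurableEquiv.measurableEmbedding _), Measure.volume_eq_prod,
    integral_prod _ hint, intervalIntegral.integral_of_le (by linarith),
    ← integral_Icc_eq_integral_Ioc, ← integral_const_mul, ← integral_indicator measurableSet_Icc]
  congr 1
  ext t
  -- The slice at height `t` is a ball of radius `√(R² - t²)` in the even dimension `2k`, so its
  -- volume is polynomial in `t`.
  by_cases ht : t ∈ Icc (-R) R
  · have h0 : 0 ≤ R ^ 2 - t ^ 2 := by nlinarith [ht.1, ht.2]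
    rw [indicator_of_mem ht]
    have : ∀ η, S.indicator (fun p => g p.1) (t, η) =
        (Metric.closedBall (0 : EuclideanSpace ℝ (Fin (2 * k))) √(R ^ 2 - t ^ 2)).indicator
          (fun _ => g t) η := fun η => by
      simp only [indicator_apply, hS, mem_ofPred_eq, mem_closedBall_zero_iff,
        Real.le_sqrt (norm_nonneg _) h0]
    have : Nontrivial (EuclideanSpace ℝ (Fin (2 * k))) :=
      Module.nontrivial_of_finrank_pos (R := ℝ) (by simp; omega)
    simp_rw [‹∀ η, _›]
    rw [integral_indicator Metric.isClosed_closedBall.measurableSet, setIntegral_const,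
      Measure.real, InnerProductSpace.volume_closedBall_of_dim_even (k := k) (by simp)]
    rw [ENNReal.toReal_mul, ENNReal.toReal_pow, ENNReal.toReal_ofReal (Real.sqrt_nonneg _),
      ENNReal.toReal_ofReal (by positivity), finrank_euclideanSpace_fin, pow_mul,
      Real.sq_sqrt h0, Complex.real_smul]
    push_cast
    ring
  · rw [indicator_of_notMem ht]
    have : ∀ η, S.indicator (fun p => g p.1) (t, η) = 0 := fun η => by
      refine indicator_of_notMem (fun h => ht ?_) _
      have h : ‖η‖ ^ 2 ≤ R ^ 2 - t ^ 2 := h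
      exact abs_le.1 (abs_le_of_sq_le_sq (by nlinarith [sq_nonneg ‖η‖]) hR)
    simp [this]

theorem integral_sq_sub_sq_pow_mul_exp (R : ℝ) (p : ℕ) (r : ℝ) :
    ∫ t in -R..R, (((R ^ 2 - t ^ 2) ^ p : ℝ) : ℂ) * Complex.exp (Complex.I * (r * t : ℝ)) =
      (ballKernel R p r : ℂ) := by
  have hsin : ∫ t in -R..R, (R ^ 2 - t ^ 2) ^ p * Real.sin (t * r) = 0 := by
    have := intervalIntegral.integral_comp_neg (a := -R) (b := R)
      (fun t => (R ^ 2 - t ^ 2) ^ p * Real.sin (t * r))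
    simp only [neg_neg, neg_sq, neg_mul, Real.sin_neg, mul_neg, intervalIntegral.integral_neg]
      at this
    linarith
  have : ∀ t : ℝ, (((R ^ 2 - t ^ 2) ^ p : ℝ) : ℂ) * Complex.exp (Complex.I * (r * t : ℝ)) =
      (((R ^ 2 - t ^ 2) ^ p * Real.cos (t * r) : ℝ) : ℂ) +
        Complex.I * (((R ^ 2 - t ^ 2) ^ p * Real.sin (t * r) : ℝ) : ℂ) := fun t => by
    rw [mul_comm Complex.I, Complex.exp_mul_I, ← Complex.ofReal_cos, ← Complex.ofReal_sin,
      mul_comm r t]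
    push_cast
    ring
  simp_rw [this]
  rw [intervalIntegral.integral_add (Continuous.intervalIntegrable (by fun_prop) _ _)
    (Continuous.intervalIntegrable (by fun_prop) _ _), intervalIntegral.integral_const_mul,
    intervalIntegral.integral_ofReal, intervalIntegral.integral_ofReal, hsin, ballKernel]
  simp

/-- The Fourier transform of the indicator of a ball in odd dimension. -/
theorem integral_closedBall_exp_inner {k : ℕ} (hk : 1 ≤ k) {R : ℝ} (hR : 0 ≤ R)
    (y : EuclideanSpace ℝ (Fin (2 * k + 1))) :
    ∫ ξ in Metric.closedBall (0 : EuclideanSpace ℝ (Fin (2 * k + 1))) R,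
        Complex.exp (Complex.I * (inner ℝ y ξ : ℝ)) =
      ((Real.pi ^ k / k.factorial * ballKernel R k ‖y‖ : ℝ) : ℂ) := by
  set z : EuclideanSpace ℝ (Fin (2 * k + 1)) := ‖y‖ • EuclideanSpace.single 0 1 with hz
  -- Reflecting in the hyperplane orthogonal to `y - z` carries `y` to the first axis and preserves
  -- the ball and its measure.
  set e := (Submodule.span ℝ {y - z})ᗮ.reflection
  have he : e y = z := Submodule.reflection_sub (by simp [hz, norm_smul])
  have hinner : ∀ ξ, inner ℝ y ξ = ‖y‖ * (e ξ) 0 := fun ξ => by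
    rw [← e.inner_map_map, he, hz, inner_smul_left, EuclideanSpace.inner_single_left]
    simp
  simp_rw [hinner]
  have hpre : Metric.closedBall (0 : EuclideanSpace ℝ (Fin (2 * k + 1))) R =
      e ⁻¹' Metric.closedBall 0 R := by
    ext ξ
    simp
  rw [hpre, (LinearIsometryEquiv.measurePreserving e).setIntegral_preimage_emb
    e.toHomeomorph.measurableEmbedding
    (fun ξ => Complex.exp (Complex.I * (‖y‖ * ξ 0 : ℝ))),
    integral_closedBall_first_coord hk hR
      (g := fun t => Complex.exp (Complex.I * (‖y‖ * t : ℝ))) (by fun_prop),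
    integral_sq_sub_sq_pow_mul_exp]
  push_cast
  rfl

/-! ### Polar coordinates for vector-valued functions. -/

section Polar

variable {E X : Type*} [NormedAddCommGroup E] [NormedSpace ℝ E] [FiniteDimensional ℝ E]
  [MeasurableSpace E] [BorelSpace E] [NormedAddCommGroup X] [NormedSpace ℝ X]

theorem integrable_volumeIoiPow_iff (m : ℕ) (g : ℝ → X) :
    Integrable (fun r : Ioi (0 : ℝ) => g r) (Measure.volumeIoiPow m) ↔
      IntegrableOn (fun r => r ^ m • g r) (Ioi 0) := by
  rw [integrableOn_iff_comap_subtypeVal measurableSet_Ioi, Measure.volumeIoiPow,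
    integrable_withDensity_iff_integrable_smul' (by fun_prop) (by simp)]
  refine integrable_congr (Eventually.of_forall fun r => ?_)
  have h : (0 : ℝ) < r := r.2
  simp only [Function.comp_apply]
  rw [ENNReal.toReal_ofReal (by positivity)]

theorem integral_volumeIoiPow (m : ℕ) (g : ℝ → X) :
    ∫ r : Ioi (0 : ℝ), g r ∂(Measure.volumeIoiPow m) = ∫ r in Ioi (0 : ℝ), r ^ m • g r := by
  simp only [Measure.volumeIoiPow, ENNReal.ofReal]
  rw [integral_withDensity_eq_integral_smul (by fun_prop),
    integral_subtype_comap measurableSet_Ioi fun a ↦ Real.toNNReal (a ^ m) • g a]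
  refine setIntegral_congr_fun measurableSet_Ioi fun r (hr : 0 < r) => ?_
  rw [NNReal.smul_def, Real.coe_toNNReal _ (by positivity)]

/-- Integration in polar coordinates. -/
theorem integral_polar [Nontrivial E] (μ : Measure E) [μ.IsAddHaarMeasure] {G : E → X}
    (hG : Integrable G μ) :
    IntegrableOn (fun r : ℝ => r ^ (Module.finrank ℝ E - 1) •
        ∫ w, G (r • (w : E)) ∂μ.toSphere) (Ioi 0) ∧
      ∫ y, G y ∂μ = ∫ r in Ioi (0 : ℝ), r ^ (Module.finrank ℝ E - 1) •
        ∫ w, G (r • (w : E)) ∂μ.toSphere := by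
  have hmp := μ.measurePreserving_homeomorphUnitSphereProd
  have hemb := (homeomorphUnitSphereProd E).measurableEmbedding
  set H : Metric.sphere (0 : E) 1 × Ioi (0 : ℝ) → X := fun p => G ((p.2 : ℝ) • (p.1 : E)) with hH
  have hcomp : H ∘ homeomorphUnitSphereProd E = fun y : ({0}ᶜ : Set E) => G y := by
    ext y
    rw [Function.comp_apply, hH]
    simp only
    rw [← homeomorphUnitSphereProd_symm_apply_coe, Homeomorph.symm_apply_apply]
  have hint : Integrable H (μ.toSphere.prod (Measure.volumeIoiPow (Module.finrank ℝ E - 1))) := by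
    rw [← hmp.integrable_comp_emb hemb, hcomp]
    exact (integrableOn_iff_comap_subtypeVal (measurableSet_singleton _).compl).1 hG.integrableOn
  refine ⟨(integrable_volumeIoiPow_iff _ fun r => ∫ w, G (r • (w : E)) ∂μ.toSphere).1
    hint.integral_prod_right, ?_⟩
  rw [← integral_volumeIoiPow _ fun r => ∫ w, G (r • (w : E)) ∂μ.toSphere,
    ← integral_prod_symm H hint, ← hmp.integral_comp hemb]
  have h0 : ∫ y, G y ∂μ = ∫ y : ({0}ᶜ : Set E), G y ∂(μ.comap (↑)) := by
    rw [integral_subtype_comap (measurableSet_singleton _).compl, restrict_compl_singleton]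
  rw [h0]
  exact integral_congr_ae (Eventually.of_forall fun y => (congrFun hcomp y).symm)

end Polar

/-! ### Reduction to a radial integral. -/

section Partial

variable {X : Type*} [NormedAddCommGroup X] [NormedSpace ℂ X] [CompleteSpace X]

/-- Fubini: the exponential has modulus one, the ball has finite measure and `F` is integrable. -/
theorem integral_exp_smul_fourierHat {n : ℕ} {F : EuclideanSpace ℝ (Fin n) → X}
    (hF : Integrable F) (R : ℝ) (x : EuclideanSpace ℝ (Fin n)) :
    Integrable (fun s => (∫ ξ in Metric.closedBall (0 : EuclideanSpace ℝ (Fin n)) R,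
        Complex.exp (Complex.I * ((inner ℝ (x - s) ξ : ℝ) : ℂ))) • F s) ∧
    ∫ ξ in Metric.closedBall (0 : EuclideanSpace ℝ (Fin n)) R,
      Complex.exp (Complex.I * ((inner ℝ x ξ : ℝ) : ℂ)) • fourierHat F ξ =
    ∫ s, (∫ ξ in Metric.closedBall (0 : EuclideanSpace ℝ (Fin n)) R,
        Complex.exp (Complex.I * ((inner ℝ (x - s) ξ : ℝ) : ℂ))) • F s := by
  set ν := (volume : Measure (EuclideanSpace ℝ (Fin n))).restrict (Metric.closedBall 0 R)
  have : IsFiniteMeasure ν := ⟨by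
    rw [Measure.restrict_apply_univ]
    exact measure_closedBall_lt_top⟩
  set Φ : EuclideanSpace ℝ (Fin n) × EuclideanSpace ℝ (Fin n) → X := fun p =>
    Complex.exp (Complex.I * ((inner ℝ (x - p.2) p.1 : ℝ) : ℂ)) • F p.2 with hΦ
  have hint : Integrable Φ (ν.prod volume) := by
    refine (hF.comp_snd ν).bdd_smul 1 (Continuous.aestronglyMeasurable (by fun_prop))
      (Eventually.of_forall fun p => ?_)
    rw [mul_comm, Complex.norm_exp_ofReal_mul_I]
  have hin : ∀ s, ∫ ξ, Φ (ξ, s) ∂ν = (∫ ξ, Complex.exp (Complex.I *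
      ((inner ℝ (x - s) ξ : ℝ) : ℂ)) ∂ν) • F s := fun s => by
    simp only [hΦ]
    exact integral_smul_const _ _
  refine ⟨hint.integral_prod_right.congr (Eventually.of_forall hin), ?_⟩
  simp_rw [← hin]
  rw [← integral_prod_symm _ hint, integral_prod _ hint]
  congr 1
  ext ξ
  rw [fourierHat, ← integral_smul]
  congr 1
  ext s
  simp only [hΦ]
  rw [smul_smul, ← Complex.exp_add, inner_sub_left, real_inner_comm ξ s]
  congr 2
  push_cast
  ring

/-- The truncated inversion integral in odd dimension, in terms of spherical means. -/
theorem fourierPartial_eq_integral_sphericalMean {k : ℕ} (hk : 1 ≤ k)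
    {F : EuclideanSpace ℝ (Fin (2 * k + 1)) → X} (hF : Integrable F) {R : ℝ} (hR : 0 ≤ R)
    (x : EuclideanSpace ℝ (Fin (2 * k + 1))) :
    IntegrableOn (fun r : ℝ => (r ^ (2 * k) * ballKernel R k r) • sphericalMean F x r) (Ioi 0) ∧
    fourierPartial R F x =
      (((2 * Real.pi) ^ (2 * k + 1))⁻¹ * (Real.pi ^ k / k.factorial) *
        (sphereMeasure (2 * k + 1)).real univ) •
      ∫ r in Ioi (0 : ℝ), (r ^ (2 * k) * ballKernel R k r) • sphericalMean F x r := by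
  obtain ⟨h1, h2⟩ := integral_exp_smul_fourierHat hF R x
  set c : ℝ := Real.pi ^ k / k.factorial with hc
  have hc0 : c ≠ 0 := by positivity
  set ω : ℝ := (sphereMeasure (2 * k + 1)).real univ with hω
  have hω0 : ω ≠ 0 := by
    rw [hω, sphereMeasure, Measure.toSphere_real_apply_univ]
    have : 0 < (volume : Measure (EuclideanSpace ℝ (Fin (2 * k + 1)))).real (Metric.ball 0 1) :=
      ENNReal.toReal_pos (Metric.measure_ball_pos _ _ one_pos).ne' measure_ball_lt_top.ne
    have h : 0 < Module.finrank ℝ (EuclideanSpace ℝ (Fin (2 * k + 1))) := by simp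
    positivity
  simp_rw [integral_closedBall_exp_inner hk hR] at h1 h2
  set G : EuclideanSpace ℝ (Fin (2 * k + 1)) → X := fun y =>
    (c * ballKernel R k ‖y‖) • F (x + y) with hG
  have hGs : ∀ y, ((c * ballKernel R k ‖x - (x + y)‖ : ℝ) : ℂ) • F (x + y) = G y := fun y => by
    rw [sub_add_cancel_left, norm_neg, hG]
    exact Complex.coe_smul _ _
  have hGi : Integrable G := by
    have := h1.comp_add_left x
    exact this.congr (Eventually.of_forall hGs)
  have hGe : ∫ s, ((c * ballKernel R k ‖x - s‖ : ℝ) : ℂ) • F s = ∫ y, G y := by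
    rw [← integral_add_left_eq_self _ x]
    exact integral_congr_ae (Eventually.of_forall hGs)
  obtain ⟨h3, h4⟩ := integral_polar volume hGi
  have hsph : ∀ r ∈ Ioi (0 : ℝ),
      r ^ (Module.finrank ℝ (EuclideanSpace ℝ (Fin (2 * k + 1))) - 1) •
        ∫ w, G (r • (w : EuclideanSpace ℝ (Fin (2 * k + 1)))) ∂(volume : Measure
          (EuclideanSpace ℝ (Fin (2 * k + 1)))).toSphere =
      (c * ω) • ((r ^ (2 * k) * ballKernel R k r) • sphericalMean F x r) := fun r hr => by
    have hr' : |r| = r := abs_of_pos hr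
    simp only [hG, norm_smul, Real.norm_eq_abs, hr', norm_eq_of_mem_sphere, mul_one]
    rw [integral_smul, sphericalMean, finrank_euclideanSpace_fin, smul_smul, smul_smul, smul_smul,
      Nat.add_sub_cancel]
    congr 1
    rw [← hω]
    field_simp
  refine ⟨?_, ?_⟩
  · have := (h3.congr_fun hsph measurableSet_Ioi).smul (c * ω)⁻¹
    refine IntegrableOn.congr_fun this (fun r _ => ?_) measurableSet_Ioi
    simp only [Pi.smul_apply]
    rw [inv_smul_smul₀ (mul_ne_zero hc0 hω0)]
  · rw [fourierPartial, h2, hGe, h4, setIntegral_congr_fun measurableSet_Ioi hsph, integral_smul,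
      smul_smul]
    congr 1
    ring

end Partial

/-! ### Smoothness of spherical means. -/

section ParametricIntegral

variable {S E X : Type*} [TopologicalSpace S] [CompactSpace S] [SecondCountableTopology S]
  [MeasurableSpace S] [OpensMeasurableSpace S] [NormedAddCommGroup E] [NormedSpace ℝ E]
  [NormedAddCommGroup X] [NormedSpace ℝ X]

theorem hasDerivAt_integral_of_contDiff (μ : Measure S) [IsFiniteMeasure μ] {v : S → E}
    (hv : Continuous v) {Ψ : ℝ × E → X} (hΨ : ContDiff ℝ 1 Ψ) (r : ℝ) :
    HasDerivAt (fun r => ∫ w, Ψ (r, v w) ∂μ) (∫ w, fderiv ℝ Ψ (r, v w) (1, 0) ∂μ) r := by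
  have hc : Continuous Ψ := hΨ.continuous
  have hc' : Continuous fun p => fderiv ℝ Ψ p (1, 0) :=
    (hΨ.continuous_fderiv one_ne_zero).clm_apply continuous_const
  have hcw : ∀ r, Continuous fun w => Ψ (r, v w) := fun r => by fun_prop
  have hcw' : ∀ r, Continuous fun w => fderiv ℝ Ψ (r, v w) (1, 0) := fun r =>
    hc'.comp (by fun_prop : Continuous fun w => (r, v w))
  obtain ⟨C, hC⟩ := ((isCompact_closedBall r 1).prod (isCompact_range hv)).exists_bound_of_continuousOn
    hc'.continuousOn
  refine (hasDerivAt_integral_of_dominated_loc_of_deriv_le (bound := fun _ => C)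
    (F := fun r w => Ψ (r, v w)) (F' := fun r w => fderiv ℝ Ψ (r, v w) (1, 0))
    (Metric.ball_mem_nhds r one_pos)
    (Eventually.of_forall fun r => (hcw r).aestronglyMeasurable) ?_
    (hcw' r).aestronglyMeasurable (Eventually.of_forall fun w s hs => ?_) (integrable_const _)
    (Eventually.of_forall fun w s _ => ?_)).2
  · obtain ⟨D, hD⟩ := isCompact_univ.exists_bound_of_continuousOn (hcw r).continuousOn
    exact Integrable.of_bound (hcw r).aestronglyMeasurable D
      (Eventually.of_forall fun w => hD w (mem_univ w))
  · exact hC _ ⟨Metric.ball_subset_closedBall hs, mem_range_self w⟩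
  · have h1 := (hΨ.differentiable one_ne_zero (s, v w)).hasFDerivAt
    exact h1.comp_hasDerivAt s ((hasDerivAt_id s).prodMk (hasDerivAt_const s (v w)))

/-- Allowing a general `Ψ` on `ℝ × E` closes the induction: the derivative is again such an
integral, of a partial derivative of `Ψ`. -/
theorem contDiff_integral_of_contDiff (μ : Measure S) [IsFiniteMeasure μ] {v : S → E}
    (hv : Continuous v) {k : ℕ} {Ψ : ℝ × E → X} (hΨ : ContDiff ℝ k Ψ) :
    ContDiff ℝ k (fun r => ∫ w, Ψ (r, v w) ∂μ) := by
  induction k generalizing Ψ with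
  | zero =>
    rw [Nat.cast_zero, contDiff_zero] at hΨ ⊢
    have : Continuous (Function.uncurry fun r w => Ψ (r, v w)) := by
      unfold Function.uncurry
      fun_prop
    simpa using continuous_parametric_integral_of_continuous (μ := μ) this isCompact_univ
  | succ k ih =>
    have h1 : ContDiff ℝ 1 Ψ := hΨ.of_le (by exact_mod_cast Nat.le_add_left 1 k)
    rw [Nat.cast_succ] at hΨ ⊢
    have hd := hasDerivAt_integral_of_contDiff μ hv h1
    rw [contDiff_succ_iff_deriv]
    refine ⟨fun r => (hd r).differentiableAt, by simp, ?_⟩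
    rw [funext fun r => (hd r).deriv]
    exact ih ((hΨ.fderiv_right le_rfl).clm_apply contDiff_const)

end ParametricIntegral

theorem contDiff_sphericalMean {X : Type*} [NormedAddCommGroup X] [NormedSpace ℂ X] {n k : ℕ}
    {F : EuclideanSpace ℝ (Fin n) → X} (hF : ContDiff ℝ k F) (x : EuclideanSpace ℝ (Fin n)) :
    ContDiff ℝ k (sphericalMean F x) := by
  have : IsFiniteMeasure (sphereMeasure n) := by
    unfold sphereMeasure
    infer_instance
  have hΨ : ContDiff ℝ k fun p : ℝ × EuclideanSpace ℝ (Fin n) => F (x + p.1 • p.2) :=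
    hF.comp (by fun_prop)
  exact (contDiff_integral_of_contDiff (sphereMeasure n) continuous_subtype_val hΨ).const_smul _

/-! ### Integration by parts against the kernel. -/

section ByParts

variable {X : Type*} [NormedAddCommGroup X] [NormedSpace ℝ X] [CompleteSpace X]

/-- The primitive is `2(p+1) r^(2p+1) A_p P`: the term with `A_p'` yields `A_{p+1}` through
`mul_ballKernel_succ`, and the power of `r` removes the endpoint `0`. -/
theorem integral_ballKernel_succ_smul (R : ℝ) (p : ℕ) {P P' : ℝ → X}
    (hP : ∀ r, HasDerivAt P (P' r) r) (hP' : Continuous P') (N : ℝ) :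
    ∫ r in 0..N, (r ^ (2 * (p + 1)) * ballKernel R (p + 1) r) • P r =
      (∫ r in 0..N, (r ^ (2 * p) * ballKernel R p r) •
        ((2 * (p + 1) : ℝ) • ((2 * p + 1 : ℝ) • P r + r • P' r))) -
      (2 * (p + 1) * (N ^ (2 * p + 1) * ballKernel R p N)) • P N := by
  have hA := continuous_ballKernel R p
  have hA' := continuous_ballKernel R (p + 1)
  have hPc : Continuous P := continuous_iff_continuousAt.2 fun r => (hP r).continuousAt
  have h : ∀ r ∈ uIcc 0 N, HasDerivAt
      (fun r => (2 * (p + 1) * (r ^ (2 * p + 1) * ballKernel R p r)) • P r)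
      ((r ^ (2 * p) * ballKernel R p r) •
        ((2 * (p + 1) : ℝ) • ((2 * p + 1 : ℝ) • P r + r • P' r)) -
        (r ^ (2 * (p + 1)) * ballKernel R (p + 1) r) • P r) r := fun r _ => by
    have h1 := (((hasDerivAt_pow (2 * p + 1) r).mul
      (hasDerivAt_ballKernel R p r)).const_mul (2 * (p + 1) : ℝ)).smul (hP r)
    convert! h1 using 1
    have h2 : r ^ (2 * (p + 1)) * ballKernel R (p + 1) r =
        r ^ (2 * p + 1) * (2 * (p + 1) * ballKernelAux R p r) := by
      rw [← mul_ballKernel_succ]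
      ring
    rw [h2]
    simp only [Nat.add_sub_cancel, Pi.mul_apply]
    push_cast
    module
  have := intervalIntegral.integral_eq_sub_of_hasDerivAt h
    (Continuous.intervalIntegrable (by fun_prop) _ _)
  rw [intervalIntegral.integral_sub (Continuous.intervalIntegrable (by fun_prop) _ _)
    (Continuous.intervalIntegrable (by fun_prop) _ _)] at this
  simp only [zero_pow (Nat.succ_ne_zero _), zero_mul, mul_zero, zero_smul, sub_zero] at this
  rw [← this]
  abel

/-- Iterated integration by parts against `ballKernel`; the coefficients depend only on `k`. -/
theorem exists_integral_ballKernel_smul_eq (k m : ℕ) (hm : m ≤ k) :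
    ∃ c : ℕ → ℝ, c 0 * (2 * (k - m)).factorial = (2 * k).factorial ∧ (∀ j, m < j → c j = 0) ∧
      ∀ (R : ℝ) (f : ℝ → X), ContDiff ℝ k f →
        (∀ l < k, Tendsto (fun r => r ^ (k - 1) • iteratedDeriv l f r) atTop (𝓝 0)) →
        ∃ B : ℝ → X, Tendsto B atTop (𝓝 0) ∧ ∀ N,
          ∫ r in 0..N, (r ^ (2 * k) * ballKernel R k r) • f r =
            (∫ r in 0..N, (r ^ (2 * (k - m)) * ballKernel R (k - m) r) •
              ∑ j ∈ Finset.range (m + 1), (c j * r ^ j) • iteratedDeriv j f r) + B N := by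
  induction m with
  | zero =>
    refine ⟨fun j => if j = 0 then 1 else 0, by simp, fun j hj => by simp [hj.ne'],
      fun R f _ _ => ⟨0, tendsto_const_nhds, fun N => by simp⟩⟩
  | succ m ih =>
    obtain ⟨c, hc0, hcm, hc⟩ := ih (by omega)
    obtain ⟨p, hp⟩ : ∃ p, k = p + 1 + m := ⟨k - (m + 1), by omega⟩
    have hp1 : k - m = p + 1 := by omega
    have hp2 : k - (m + 1) = p := by omega
    rw [hp1] at hc0 hc
    rw [hp2]
    -- The operator `(2p+1) + r d/dr` sends `r^j f^(j)` to `(2p+1+j) r^j f^(j) + r^(j+1) f^(j+1)`.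
    -- In particular `c 0` is multiplied by `(2p+2)(2p+1)`, which telescopes to a quotient of
    -- factorials.
    refine ⟨fun j => 2 * (p + 1) * ((2 * p + 1 + j) * c j + if j = 0 then 0 else c (j - 1)),
      ?_, ?_, ?_⟩
    · rw [← hc0, show 2 * (p + 1) = 2 * p + 1 + 1 by ring, Nat.factorial_succ, Nat.factorial_succ]
      push_cast
      ring
    · intro j hj
      simp only
      rw [hcm j (by omega), if_neg (by omega), hcm (j - 1) (by omega)]
      simp
    · intro R f hf hdec
      obtain ⟨B, hB, hBN⟩ := hc R f hf hdec
      have hcont : ∀ j ≤ k, Continuous (iteratedDeriv j f) := fun j hj =>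
        hf.continuous_iteratedDeriv j (by exact_mod_cast hj)
      have hderiv : ∀ j < k, ∀ r, HasDerivAt (iteratedDeriv j f) (iteratedDeriv (j + 1) f r) r :=
        fun j hj r => by
          rw [iteratedDeriv_succ]
          exact (hf.differentiable_iteratedDeriv j (by exact_mod_cast hj) r).hasDerivAt
      set P : ℝ → X := fun r =>
        ∑ j ∈ Finset.range (m + 1), (c j * r ^ j) • iteratedDeriv j f r with hP
      set P' : ℝ → X := fun r => ∑ j ∈ Finset.range (m + 1),
        ((c j * r ^ j) • iteratedDeriv (j + 1) f r +
          (c j * (j * r ^ (j - 1))) • iteratedDeriv j f r) with hP'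
      have hPd : ∀ r, HasDerivAt P (P' r) r := fun r => by
        refine HasDerivAt.fun_sum fun j hj => ?_
        rw [Finset.mem_range] at hj
        exact ((hasDerivAt_pow j r).const_mul (c j)).smul (hderiv j (by omega) r)
      have hP'c : Continuous P' := by
        refine continuous_finsetSum _ fun j hj => ?_
        rw [Finset.mem_range] at hj
        have h1 := hcont j (by omega)
        have h2 := hcont (j + 1) (by omega)
        fun_prop
      refine ⟨fun N => B N - (2 * (p + 1) * (N ^ (2 * p + 1) * ballKernel R p N)) • P N, ?_, ?_⟩
      · rw [← sub_zero (0 : X)]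
        refine hB.sub ?_
        obtain ⟨C, hC0, hC⟩ := exists_abs_ballKernel_le R p
        have hlim : Tendsto (fun N : ℝ => ∑ j ∈ Finset.range (m + 1),
            (2 * (p + 1) * C * |c j|) * ‖N ^ (k - 1) • iteratedDeriv j f N‖) atTop (𝓝 0) := by
          have h0 : ∑ j ∈ Finset.range (m + 1), (0 : ℝ) = 0 := Finset.sum_const_zero
          refine h0 ▸ tendsto_finsetSum _ fun j hj => ?_
          rw [Finset.mem_range] at hj
          simpa using (hdec j (by omega)).norm.const_mul (2 * (p + 1) * C * |c j|)
        refine squeeze_zero_norm' ?_ hlim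
        filter_upwards [eventually_ge_atTop (1 : ℝ)] with N hN
        have hN0 : 0 < N := by linarith
        rw [hP]
        simp only
        rw [Finset.smul_sum]
        refine (norm_sum_le _ _).trans (Finset.sum_le_sum fun j hj => ?_)
        rw [Finset.mem_range] at hj
        simp only [norm_smul, Real.norm_eq_abs, abs_mul, abs_pow, abs_of_pos hN0, abs_two]
        rw [abs_of_nonneg (by positivity : (0 : ℝ) ≤ p + 1)]
        -- Of `N^(2p+1+j)`, the factor `N^(p+1)` is absorbed by the kernel; `j ≤ m` and `p + 1 + m =
        -- k` leave at most `N^(k-1)`.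
        have h1 : N ^ (p + j) ≤ N ^ (k - 1) := pow_le_pow_right₀ hN (by omega)
        calc _ = 2 * (p + 1) * (N ^ (p + 1) * |ballKernel R p N|) * |c j| *
              (N ^ (p + j) * ‖iteratedDeriv j f N‖) := by ring
          _ ≤ 2 * (p + 1) * C * |c j| * (N ^ (k - 1) * ‖iteratedDeriv j f N‖) := by
            gcongr
            exact (hC N hN).1
      · intro N
        rw [hBN N, integral_ballKernel_succ_smul R p hPd hP'c N]
        have : ∀ r, (2 * (p + 1) : ℝ) • ((2 * p + 1 : ℝ) • P r + r • P' r) =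
            ∑ j ∈ Finset.range (m + 1 + 1), (2 * (p + 1) *
              ((2 * p + 1 + j) * c j + if j = 0 then 0 else c (j - 1)) * r ^ j) •
                iteratedDeriv j f r := fun r => by
          have e1 : ∑ j ∈ Finset.range (m + 1 + 1),
              ((2 * p + 1 + j) * c j * r ^ j) • iteratedDeriv j f r =
              ∑ j ∈ Finset.range (m + 1),
                ((2 * p + 1 + j) * c j * r ^ j) • iteratedDeriv j f r := by
            rw [Finset.sum_range_succ, hcm (m + 1) (by omega)]
            simp
          have e2 : ∑ j ∈ Finset.range (m + 1 + 1),
              ((if j = 0 then 0 else c (j - 1)) * r ^ j) • iteratedDeriv j f r =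
              ∑ j ∈ Finset.range (m + 1), (c j * r ^ (j + 1)) • iteratedDeriv (j + 1) f r := by
            rw [Finset.sum_range_succ']
            simp
          have e3 : ∑ j ∈ Finset.range (m + 1 + 1), (2 * (p + 1) *
              ((2 * p + 1 + j) * c j + if j = 0 then 0 else c (j - 1)) * r ^ j) •
                iteratedDeriv j f r = (2 * (p + 1) : ℝ) • (∑ j ∈ Finset.range (m + 1 + 1),
              ((2 * p + 1 + j) * c j * r ^ j) • iteratedDeriv j f r +
              ∑ j ∈ Finset.range (m + 1 + 1),
              ((if j = 0 then 0 else c (j - 1)) * r ^ j) • iteratedDeriv j f r) := by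
            rw [← Finset.sum_add_distrib, Finset.smul_sum]
            refine Finset.sum_congr rfl fun j _ => ?_
            module
          rw [e3, e1, e2, hP, hP', ← Finset.sum_add_distrib]
          simp only
          rw [Finset.smul_sum, Finset.smul_sum, ← Finset.sum_add_distrib]
          congr 1
          refine Finset.sum_congr rfl fun j _ => ?_
          rcases j with _ | j
          · simp only [Nat.cast_zero, zero_mul, mul_zero, zero_smul]
            module
          · simp only [Nat.add_sub_cancel]
            push_cast
            module
        simp_rw [this]
        abel

end ByParts

/-! ### Riemann–Lebesgue lemma, uniform on compact sets. -/

section RiemannLebesgue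

variable {X : Type*} [NormedAddCommGroup X] [NormedSpace ℂ X]

theorem tendsto_integral_sin_smul {g : ℝ → X} (hg : IntegrableOn g (Ioi 0)) :
    Tendsto (fun R : ℝ => ∫ r in Ioi (0 : ℝ), Real.sin (R * r) • g r) atTop (𝓝 0) := by
  set h : ℝ → X := (Ioi 0).indicator g
  have hh : Integrable h := hg.integrable_indicator measurableSet_Ioi
  have hexp : ∀ c : ℝ, c ≠ 0 → Tendsto (fun R : ℝ =>
      ∫ r, Complex.exp ((c * R * r : ℝ) * Complex.I) • h r) atTop (𝓝 0) := fun c hc => by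
    -- The factor `-c / (2π)` converts to the normalization `e^{-2πi}` of the library's character.
    have h1 : Tendsto (fun R : ℝ => (-c / (2 * Real.pi)) * R) atTop (cocompact ℝ) :=
      (Filter.tendsto_cocompact_mul_left₀ (div_ne_zero (neg_ne_zero.2 hc) (by positivity))).comp
        (tendsto_id.mono_left atTop_le_cocompact)
    refine ((Real.tendsto_integral_exp_smul_cocompact h).comp h1).congr fun R => ?_
    refine integral_congr_ae (Eventually.of_forall fun r => ?_)
    simp only [Circle.smul_def, Real.fourierChar_apply]
    congr 4
    field_simp
  have hlim := ((hexp 1 one_ne_zero).sub (hexp (-1) (by norm_num))).const_smul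
    ((2 * Complex.I)⁻¹ : ℂ)
  rw [sub_zero, smul_zero] at hlim
  refine hlim.congr fun R => ?_
  have hint : ∀ c : ℝ, Integrable fun r : ℝ => Complex.exp ((c * R * r : ℝ) * Complex.I) • h r :=
    fun c => hh.bdd_smul 1 (Continuous.aestronglyMeasurable (by fun_prop))
      (Eventually.of_forall fun r => by rw [Complex.norm_exp_ofReal_mul_I])
  rw [← integral_sub (hint 1) (hint (-1)), ← integral_smul, ← integral_indicator measurableSet_Ioi]
  refine integral_congr_ae (Eventually.of_forall fun r => ?_)
  have h2 : (Ioi (0 : ℝ)).indicator (fun r => Real.sin (R * r) • g r) r =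
      Real.sin (R * r) • h r := by
    by_cases hr : r ∈ Ioi (0 : ℝ) <;> simp [h, hr]
  simp only
  rw [h2, ← sub_smul, smul_smul, ← Complex.coe_smul]
  congr 1
  rw [Complex.exp_mul_I, Complex.exp_mul_I]
  push_cast
  rw [one_mul, neg_one_mul, neg_mul, Complex.cos_neg, Complex.sin_neg]
  field_simp
  ring

theorem integrableOn_sin_smul {g : ℝ → X} {s : Set ℝ} (hg : IntegrableOn g s) (R : ℝ) :
    IntegrableOn (fun r => Real.sin (R * r) • g r) s := by
  have hsin : Continuous fun r => Real.sin (R * r) := by fun_prop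
  refine Integrable.mono hg (hsin.aestronglyMeasurable.smul hg.aestronglyMeasurable)
    (Eventually.of_forall fun r => ?_)
  rw [norm_smul]
  exact mul_le_of_le_one_left (norm_nonneg _) (Real.abs_sin_le_one _)

/-- The Riemann–Lebesgue lemma, uniformly on compact subsets of `L¹`. -/
theorem IsCompactInL1.eventually_norm_integral_sin_smul_lt {S : Set (ℝ → X)}
    (hS : IsCompactInL1 S) {ε : ℝ} (hε : 0 < ε) :
    ∀ᶠ R : ℝ in atTop, ∀ g ∈ S, ‖∫ r in Ioi (0 : ℝ), Real.sin (R * r) • g r‖ < ε := by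
  obtain ⟨hint, hcomp⟩ := hS
  -- A finite `ε/2`-net suffices: since `|sin| ≤ 1`, replacing `g` by a net point costs at most
  -- their `L¹` distance, whatever `R` is.
  obtain ⟨t, ht, hcover⟩ := Metric.totallyBounded_iff.1 hcomp.totallyBounded (ε / 2) (half_pos hε)
  have hev : ∀ᶠ R : ℝ in atTop, ∀ y ∈ t,
      ‖∫ r in Ioi (0 : ℝ), Real.sin (R * r) • (y : ℝ → X) r‖ < ε / 2 := by
    rw [Filter.eventually_all_finite ht]
    intro y _
    have := (tendsto_integral_sin_smul (L1.integrable_coeFn y)).norm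
    rw [norm_zero] at this
    exact this.eventually_lt_const (half_pos hε)
  filter_upwards [hev] with R hR g hg
  have hfg : ((hint g hg).toL1 g : ℝ → X) =ᵐ[volume.restrict (Ioi 0)] g := Integrable.coeFn_toL1 _
  obtain ⟨y, hy, hdist⟩ := mem_iUnion₂.1 (hcover ⟨g, hg, hfg⟩)
  have hyi : IntegrableOn (y : ℝ → X) (Ioi 0) := L1.integrable_coeFn y
  have hint1 : IntegrableOn (fun r => g r - (y : ℝ → X) r) (Ioi 0) := (hint g hg).sub hyi
  have hdiff : ‖∫ r in Ioi (0 : ℝ), Real.sin (R * r) • (g r - (y : ℝ → X) r)‖ < ε / 2 := by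
    rw [Metric.mem_ball, dist_eq_norm, L1.norm_eq_integral_norm] at hdist
    refine lt_of_le_of_lt ?_ hdist
    refine (norm_integral_le_integral_norm _).trans (integral_mono_ae
      (integrableOn_sin_smul hint1 R).norm (L1.integrable_coeFn _).norm ?_)
    filter_upwards [hfg, Lp.coeFn_sub ((hint g hg).toL1 g) y] with r h1 h2
    rw [h2, Pi.sub_apply, h1, norm_smul]
    exact mul_le_of_le_one_left (norm_nonneg _) (Real.abs_sin_le_one _)
  have hsplit : ∫ r in Ioi (0 : ℝ), Real.sin (R * r) • g r =
      (∫ r in Ioi (0 : ℝ), Real.sin (R * r) • (g r - (y : ℝ → X) r)) +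
        ∫ r in Ioi (0 : ℝ), Real.sin (R * r) • (y : ℝ → X) r := by
    rw [← integral_add (integrableOn_sin_smul hint1 R) (integrableOn_sin_smul hyi R)]
    simp only [smul_sub, sub_add_cancel]
  rw [hsplit]
  linarith [norm_add_le (∫ r in Ioi (0 : ℝ), Real.sin (R * r) • (g r - (y : ℝ → X) r))
    (∫ r in Ioi (0 : ℝ), Real.sin (R * r) • (y : ℝ → X) r), hR y hy]

end RiemannLebesgue

/-! ### The Dirichlet integral. -/

section DirichletIntegral

theorem integral_exp_neg_mul_sin (s T : ℝ) :
    ∫ r in 0..T, Real.exp (-(r * s)) * Real.sin r =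
      (1 + s ^ 2)⁻¹ - Real.exp (-(T * s)) * (Real.cos T + s * Real.sin T) * (1 + s ^ 2)⁻¹ := by
  have hs : 1 + s ^ 2 ≠ 0 := by positivity
  have h : ∀ r ∈ uIcc 0 T, HasDerivAt (fun r =>
      -(Real.exp (-(r * s)) * (Real.cos r + s * Real.sin r) * (1 + s ^ 2)⁻¹))
      (Real.exp (-(r * s)) * Real.sin r) r := fun r _ => by
    have h1 : HasDerivAt (fun r => Real.exp (-(r * s))) (Real.exp (-(r * s)) * (-s)) r := by
      simpa using ((hasDerivAt_id r).mul_const s).neg.exp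
    have h2 : HasDerivAt (fun r => Real.cos r + s * Real.sin r)
        (-Real.sin r + s * Real.cos r) r :=
      (Real.hasDerivAt_cos r).add ((Real.hasDerivAt_sin r).const_mul s)
    convert! ((h1.mul h2).mul_const (1 + s ^ 2)⁻¹).neg using 1
    field_simp
    ring
  rw [intervalIntegral.integral_eq_sub_of_hasDerivAt h
    (Continuous.intervalIntegrable (by fun_prop) _ _)]
  simp
  ring

theorem integrableOn_exp_neg_mul_Ioi {r : ℝ} (hr : 0 < r) :
    IntegrableOn (fun s => Real.exp (-(r * s))) (Ioi 0) ∧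
      ∫ s in Ioi (0 : ℝ), Real.exp (-(r * s)) = r⁻¹ := by
  have h1 : ∀ s : ℝ, -(r * s) = -r * s := fun s => by ring
  simp_rw [h1]
  refine ⟨exp_neg_integrableOn_Ioi 0 hr, ?_⟩
  rw [integral_exp_mul_Ioi (by linarith)]
  simp [neg_div_neg_eq]

/-- Write `1/r = ∫ e^{-rs} ds` and swap. The inner integral is explicit: `1/(1+s²)` contributes
`π/2`, and the remainder is at most `2 e^{-Ts}`, of integral `2/T`. -/
theorem abs_integral_sinc_sub_le {T : ℝ} (hT : 0 < T) :
    |(∫ r in Ioc 0 T, Real.sin r * r⁻¹) - Real.pi / 2| ≤ 2 / T := by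
  set μ := (volume : Measure ℝ).restrict (Ioc 0 T)
  set ν := (volume : Measure ℝ).restrict (Ioi 0)
  have hcont : Continuous fun p : ℝ × ℝ => Real.exp (-(p.1 * p.2)) * Real.sin p.1 := by fun_prop
  have hint : Integrable (fun p : ℝ × ℝ => Real.exp (-(p.1 * p.2)) * Real.sin p.1)
      (μ.prod ν) := by
    rw [integrable_prod_iff hcont.aestronglyMeasurable]
    constructor
    · filter_upwards [ae_restrict_mem measurableSet_Ioc] with r hr
      exact (integrableOn_exp_neg_mul_Ioi hr.1).1.mul_const _
    · refine Integrable.congr (f := fun r => r⁻¹ * |Real.sin r|) ?_ ?_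
      · refine Integrable.of_bound (by fun_prop) 1 ?_
        filter_upwards [ae_restrict_mem measurableSet_Ioc] with r hr
        have h0 : 0 < r := hr.1
        rw [Real.norm_eq_abs, abs_of_nonneg (by positivity), inv_mul_le_iff₀ h0, mul_one]
        exact (Real.abs_sin_le_abs).trans (abs_of_pos h0).le
      · filter_upwards [ae_restrict_mem measurableSet_Ioc] with r hr
        simp only [norm_mul, Real.norm_eq_abs, Real.abs_exp]
        rw [integral_mul_const, (integrableOn_exp_neg_mul_Ioi hr.1).2]
  have hswap := integral_integral_swap (f := fun r s => Real.exp (-(r * s)) * Real.sin r) hint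
  have hl : ∫ r, ∫ s, Real.exp (-(r * s)) * Real.sin r ∂ν ∂μ =
      ∫ r in Ioc 0 T, Real.sin r * r⁻¹ := by
    refine setIntegral_congr_fun measurableSet_Ioc fun r hr => ?_
    rw [integral_mul_const, (integrableOn_exp_neg_mul_Ioi hr.1).2, mul_comm]
  have hr : ∀ s, ∫ r, Real.exp (-(r * s)) * Real.sin r ∂μ =
      (1 + s ^ 2)⁻¹ - Real.exp (-(T * s)) * (Real.cos T + s * Real.sin T) * (1 + s ^ 2)⁻¹ :=
    fun s => by rw [← integral_exp_neg_mul_sin, intervalIntegral.integral_of_le hT.le]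
  have hbound : ∀ s ∈ Ioi (0 : ℝ), ‖Real.exp (-(T * s)) * (Real.cos T + s * Real.sin T) *
      (1 + s ^ 2)⁻¹‖ ≤ 2 * Real.exp (-(T * s)) := fun s (hs : 0 < s) => by
    rw [norm_mul, norm_mul, Real.norm_eq_abs, Real.abs_exp, norm_inv, Real.norm_eq_abs,
      Real.norm_eq_abs, abs_of_pos (by positivity : 0 < 1 + s ^ 2), mul_assoc, mul_comm]
    gcongr
    rw [mul_inv_le_iff₀ (by positivity)]
    refine (abs_add_le _ _).trans ?_
    rw [abs_mul, abs_of_pos hs]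
    have h1 := Real.abs_cos_le_one T
    have h2 := mul_le_of_le_one_right hs.le (Real.abs_sin_le_one T)
    nlinarith [sq_nonneg (s - 1)]
  obtain ⟨he, he'⟩ := integrableOn_exp_neg_mul_Ioi hT
  have hi2 : IntegrableOn (fun s => Real.exp (-(T * s)) * (Real.cos T + s * Real.sin T) *
      (1 + s ^ 2)⁻¹) (Ioi 0) := by
    refine Integrable.mono' (he.const_mul 2) (by fun_prop) ?_
    filter_upwards [ae_restrict_mem measurableSet_Ioi] with s hs using hbound s hs
  rw [← hl, hswap]
  simp_rw [hr]
  rw [integral_sub integrable_inv_one_add_sq.integrableOn hi2, integral_Ioi_inv_one_add_sq,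
    Real.arctan_zero, sub_zero, sub_sub_cancel_left, abs_neg, ← Real.norm_eq_abs]
  refine (norm_integral_le_of_norm_le (he.const_mul 2) ?_).trans ?_
  · filter_upwards [ae_restrict_mem measurableSet_Ioi] with s hs using hbound s hs
  · rw [integral_const_mul, he', div_eq_mul_inv]

theorem tendsto_integral_sin_mul_inv {δ : ℝ} (hδ : 0 < δ) :
    Tendsto (fun R : ℝ => ∫ r in Ioc 0 δ, Real.sin (R * r) * r⁻¹) atTop (𝓝 (Real.pi / 2)) := by
  have hlim : Tendsto (fun R : ℝ => 2 / (δ * R)) atTop (𝓝 0) :=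
    Tendsto.const_div_atTop (tendsto_id.const_mul_atTop hδ) 2
  rw [tendsto_iff_norm_sub_tendsto_zero]
  refine squeeze_zero' (Eventually.of_forall fun _ => norm_nonneg _) ?_ hlim
  filter_upwards [eventually_gt_atTop (0 : ℝ)] with R hR
  have hRδ : 0 < δ * R := by positivity
  have h1 := intervalIntegral.integral_comp_mul_left (a := 0) (b := δ)
    (fun r => Real.sin r * r⁻¹) hR.ne'
  rw [mul_zero, mul_comm R δ, intervalIntegral.integral_of_le hδ.le,
    intervalIntegral.integral_of_le hRδ.le, smul_eq_mul, eq_inv_mul_iff_mul_eq₀ hR.ne',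
    ← integral_const_mul] at h1
  have h2 : ∫ r in Ioc 0 δ, Real.sin (R * r) * r⁻¹ =
      ∫ r in Ioc 0 δ, R * (Real.sin (R * r) * (R * r)⁻¹) := by
    congr 1
    ext r
    rw [mul_inv]
    field_simp
  rw [h2, h1]
  exact abs_integral_sinc_sub_le hRδ

end DirichletIntegral

/-! ### Decay at infinity and assembly. -/

/-- The function and its derivative are both integrable, so it tends to zero. Differentiating the
weight calls on level `k - 1` of the hypothesis, except when `k = 1` and the weight is constant. -/
theorem tendsto_pow_smul_iteratedDeriv {X : Type*} [NormedAddCommGroup X] [NormedSpace ℝ X] {k : ℕ}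
    {f : ℝ → X} (hf : ContDiff ℝ k f)
    (hint : ∀ j, 1 ≤ j → j ≤ k → ∀ l ≤ j,
      IntegrableOn (fun r => r ^ (j - 1) • iteratedDeriv l f r) (Ioi 0)) {l : ℕ} (hl : l < k) :
    Tendsto (fun r => r ^ (k - 1) • iteratedDeriv l f r) atTop (𝓝 0) := by
  have hd : ∀ r ∈ Ioi (0 : ℝ), HasDerivAt (fun r => r ^ (k - 1) • iteratedDeriv l f r)
      (r ^ (k - 1) • iteratedDeriv (l + 1) f r +
        (((k - 1 : ℕ) : ℝ) * r ^ (k - 1 - 1)) • iteratedDeriv l f r) r := fun r _ => by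
    have h1 : HasDerivAt (iteratedDeriv l f) (iteratedDeriv (l + 1) f r) r := by
      rw [iteratedDeriv_succ]
      exact (hf.differentiable_iteratedDeriv l (by exact_mod_cast hl) r).hasDerivAt
    exact (hasDerivAt_pow (k - 1) r).smul h1
  refine tendsto_zero_of_hasDerivAt_of_integrableOn_Ioi hd ?_ (hint k (by omega) le_rfl l hl.le)
  refine (hint k (by omega) le_rfl (l + 1) hl).add ?_
  rcases Nat.lt_or_ge k 2 with h | h
  · have h0 : k - 1 = 0 := by omega
    simp [h0]
  · have := (hint (k - 1) (by omega) (by omega) l (by omega)).smul (((k - 1 : ℕ) : ℝ))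
    refine this.congr (Eventually.of_forall fun r => ?_)
    simp only [Pi.smul_apply, smul_smul]

section Main

variable {X : Type*} [NormedAddCommGroup X] [NormedSpace ℂ X] [CompleteSpace X]

/-- The sphere's area comes from the odd-dimensional ball volume; `(2k+1)! = (2k+1)‼ · 2^k k!` then
cancels all factorials. -/
theorem inversion_constant {k : ℕ} {c : ℝ} (hc : c = (2 * k).factorial) :
    (((2 * Real.pi) ^ (2 * k + 1))⁻¹ * (Real.pi ^ k / k.factorial) *
      (sphereMeasure (2 * k + 1)).real univ) * c = 1 / Real.pi := by
  have h1 : (sphereMeasure (2 * k + 1)).real univ * (2 * k + 1).doubleFactorial =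
      (2 * k + 1) * (Real.pi ^ k * 2 ^ (k + 1)) := by
    rw [sphereMeasure, Measure.toSphere_real_apply_univ, Measure.real,
      InnerProductSpace.volume_ball_of_dim_odd (k := k) (by simp), finrank_euclideanSpace_fin,
      ENNReal.ofReal_one, one_pow, one_mul, ENNReal.toReal_ofReal (by positivity)]
    have : ((2 * k + 1).doubleFactorial : ℝ) ≠ 0 :=
      Nat.cast_ne_zero.2 (Nat.doubleFactorial_pos _).ne'
    push_cast
    field_simp
  have h2 : ((2 * k + 1) * (2 * k).factorial : ℝ) =
      (2 * k + 1).doubleFactorial * (2 ^ k * k.factorial) := by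
    have := Nat.factorial_eq_mul_doubleFactorial (2 * k)
    rw [Nat.doubleFactorial_two_mul, Nat.factorial_succ] at this
    exact_mod_cast this
  have hd : ((2 * k + 1).doubleFactorial : ℝ) ≠ 0 :=
    Nat.cast_ne_zero.2 (Nat.doubleFactorial_pos _).ne'
  have hk : (k.factorial : ℝ) ≠ 0 := Nat.cast_ne_zero.2 k.factorial_ne_zero
  have hω : (sphereMeasure (2 * k + 1)).real univ * (2 * k).factorial =
      Real.pi ^ k * 2 ^ (k + 1) * (2 ^ k * k.factorial) := by
    apply mul_right_cancel₀ hd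
    calc _ = (sphereMeasure (2 * k + 1)).real univ * (2 * k + 1).doubleFactorial *
          (2 * k).factorial := by ring
      _ = ((2 * k + 1) * (2 * k).factorial) * (Real.pi ^ k * 2 ^ (k + 1)) := by rw [h1]; ring
      _ = _ := by rw [h2]; ring
  rw [hc, mul_assoc, hω]
  field_simp
  ring

theorem integral_indicator_sin_mul_inv_smul {δ : ℝ} (R : ℝ) (v : X) :
    IntegrableOn ((Ioo 0 δ).indicator fun r => (Real.sin (R * r) * r⁻¹) • v) (Ioi 0) ∧
      ∫ r in Ioi (0 : ℝ), (Ioo 0 δ).indicator (fun r => (Real.sin (R * r) * r⁻¹) • v) r =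
        (∫ r in Ioc 0 δ, Real.sin (R * r) * r⁻¹) • v := by
  constructor
  · have h : IntegrableOn (fun r => Real.sin (R * r) * r⁻¹) (Ioo 0 δ) := by
      refine Measure.integrableOn_of_bounded (M := |R|) (by simp) (by fun_prop) ?_
      filter_upwards [ae_restrict_mem measurableSet_Ioo] with r hr
      have h0 : 0 < r := hr.1
      rw [norm_mul, norm_inv, Real.norm_eq_abs, Real.norm_eq_abs, abs_of_pos h0,
        mul_inv_le_iff₀ h0]
      exact Real.abs_sin_le_abs.trans (by rw [abs_mul, abs_of_pos h0])
    have hv : IntegrableOn (fun r => (Real.sin (R * r) * r⁻¹) • v) (Ioo 0 δ) := h.smul_const v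
    exact (hv.integrable_indicator measurableSet_Ioo).integrableOn
  · rw [setIntegral_indicator measurableSet_Ioo, inter_eq_right.2 Ioo_subset_Ioi_self,
      ← integral_Ioc_eq_integral_Ioo, integral_smul_const]

/-- The truncated inversion integral as a sum of oscillating integrals; the coefficients depend
only on the dimension. -/
theorem exists_fourierPartial_eq {k : ℕ} (hk : 1 ≤ k) :
    ∃ d : ℕ → ℝ, ∀ (F : EuclideanSpace ℝ (Fin (2 * k + 1)) → X), Integrable F → ContDiff ℝ k F →
      ∀ (x : EuclideanSpace ℝ (Fin (2 * k + 1))) (δ R : ℝ), 0 ≤ R →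
      IntegrableOn (fun r : ℝ =>
        r⁻¹ • (sphericalMean F x r - (Ioo 0 δ).indicator (fun _ => F x) r)) (Ioi 0) →
      (∀ j, 1 ≤ j → j ≤ k → ∀ l ≤ j,
        IntegrableOn (fun r => r ^ (j - 1) • iteratedDeriv l (sphericalMean F x) r) (Ioi 0)) →
      fourierPartial R F x =
        (2 / Real.pi) • (∫ r in Ioi (0 : ℝ), Real.sin (R * r) •
          (r⁻¹ • (sphericalMean F x r - (Ioo 0 δ).indicator (fun _ => F x) r))) +
        (2 / Real.pi * ∫ r in Ioc 0 δ, Real.sin (R * r) * r⁻¹) • F x +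
        ∑ j ∈ Finset.range k, d j • ∫ r in Ioi (0 : ℝ),
          Real.sin (R * r) • (r ^ j • iteratedDeriv (j + 1) (sphericalMean F x) r) := by
  obtain ⟨c, hc0, -, hc⟩ := exists_integral_ballKernel_smul_eq (X := X) k k le_rfl
  simp only [Nat.sub_self, mul_zero, Nat.factorial_zero, Nat.cast_one, mul_one, pow_zero, one_mul]
    at hc0 hc
  set κ : ℝ := ((2 * Real.pi) ^ (2 * k + 1))⁻¹ * (Real.pi ^ k / k.factorial) *
      (sphereMeasure (2 * k + 1)).real univ with hκ
  have hκc : κ * c 0 = 1 / Real.pi := inversion_constant hc0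
  refine ⟨fun j => κ * (2 * c (j + 1)), fun F hF hFd x δ R hR h0 hj => ?_⟩
  obtain ⟨hi, heq⟩ := fourierPartial_eq_integral_sphericalMean hk hF hR x
  set f := sphericalMean F x with hf
  have hfd : ContDiff ℝ k f := contDiff_sphericalMean hFd x
  set g : ℝ → X := fun r => r⁻¹ • (f r - (Ioo 0 δ).indicator (fun _ => F x) r) with hg
  set u : ℝ → X := (Ioo 0 δ).indicator fun r => (Real.sin (R * r) * r⁻¹) • F x with hu
  obtain ⟨B, hB, hBN⟩ := hc R f hfd fun l hl => tendsto_pow_smul_iteratedDeriv hfd hj hl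
  obtain ⟨hui, hueq⟩ := integral_indicator_sin_mul_inv_smul (δ := δ) R (F x)
  have hgi := (integrableOn_sin_smul h0 R).smul (2 * c 0)
  have hui' := hui.smul (2 * c 0)
  have hji : ∀ j ∈ Finset.range k, IntegrableOn (fun r => (2 * c (j + 1)) •
      (Real.sin (R * r) • (r ^ j • iteratedDeriv (j + 1) f r))) (Ioi 0) := fun j hjk => by
    rw [Finset.mem_range] at hjk
    exact (integrableOn_sin_smul (hj (j + 1) (by omega) hjk (j + 1) le_rfl) R).smul
      (2 * c (j + 1))
  have hH : ∀ r ∈ Ioi (0 : ℝ), ballKernel R 0 r •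
      ∑ j ∈ Finset.range (k + 1), (c j * r ^ j) • iteratedDeriv j f r =
      ((2 * c 0) • (Real.sin (R * r) • g r) + (2 * c 0) • u r) +
        ∑ j ∈ Finset.range k, (2 * c (j + 1)) •
          (Real.sin (R * r) • (r ^ j • iteratedDeriv (j + 1) f r)) := fun r hr => by
    have hr0 : r ≠ 0 := (mem_Ioi.1 hr).ne'
    have hA : ballKernel R 0 r = 2 * Real.sin (R * r) * r⁻¹ := by
      rw [← mul_ballKernel_zero]
      field_simp
    -- `f r / r` need not be integrable at `0`; subtracting `F x` there gives `g`, and `u` restores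
    -- it with the sine, which tames `1/r`.
    have hgu : Real.sin (R * r) • g r + u r = (Real.sin (R * r) * r⁻¹) • f r := by
      by_cases hrδ : r ∈ Ioo 0 δ
      · simp only [hg, hu, indicator_of_mem hrδ]
        module
      · simp only [hg, hu, indicator_of_notMem hrδ]
        module
    rw [← smul_add, hgu, Finset.sum_range_succ', smul_add, Finset.smul_sum, add_comm, hA]
    congr 1
    · simp only [pow_zero, mul_one, iteratedDeriv_zero]
      module
    · refine Finset.sum_congr rfl fun j _ => ?_
      simp only [smul_smul]
      congr 1
      rw [pow_succ]
      field_simp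
  have hHi : IntegrableOn (fun r => ballKernel R 0 r •
      ∑ j ∈ Finset.range (k + 1), (c j * r ^ j) • iteratedDeriv j f r) (Ioi 0) := by
    refine IntegrableOn.congr_fun ?_ (fun r hr => (hH r hr).symm) measurableSet_Ioi
    exact (hgi.add hui').add (integrable_finsetSum _ hji)
  have hlim1 := intervalIntegral_tendsto_integral_Ioi 0 hi tendsto_id
  have hlim2 := (intervalIntegral_tendsto_integral_Ioi 0 hHi tendsto_id).add hB
  rw [add_zero] at hlim2
  -- Both improper integrals converge absolutely and `B` tends to zero, so the identity on `[0, N]`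
  -- passes to the limit.
  have hI := tendsto_nhds_unique (hlim1.congr hBN) hlim2
  have hadd1 := integral_add (hgi.add hui') (integrable_finsetSum _ hji)
  have hadd2 := integral_add hgi hui'
  simp only [Pi.add_apply, Pi.smul_apply] at hadd1 hadd2
  rw [heq, hI, setIntegral_congr_fun measurableSet_Ioi hH, hadd1, hadd2,
    integral_finsetSum _ hji, integral_smul, integral_smul, hueq, smul_add, smul_add,
    Finset.smul_sum]
  have e : 2 / Real.pi = κ * (2 * c 0) := by
    rw [mul_left_comm, hκc]
    ring
  rw [e]
  congr 1
  · module
  · refine Finset.sum_congr rfl fun j _ => ?_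
    rw [integral_smul, smul_smul]

end Main

theorem mainTheorem6 {X : Type*} [NormedAddCommGroup X] [NormedSpace ℂ X] [CompleteSpace X]
    (n k : ℕ) (hk : 1 ≤ k) (hn : n = 2 * k + 1)
    (K : Set (EuclideanSpace ℝ (Fin n))) (hK : IsCompact K)
    (F : EuclideanSpace ℝ (Fin n) → X)
    (hF_int : Integrable F) (hF_diff : ContDiff ℝ k F)
    (δ : ℝ) (hδ : 0 < δ)
    (hcomp_zero : IsCompactInL1
      {g : ℝ → X | ∃ x ∈ K, g = fun r : ℝ =>
        r⁻¹ • (sphericalMean F x r - (Ioo 0 δ).indicator (fun _ => F x) r)})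
    (hcomp_deriv : ∀ j : ℕ, 1 ≤ j → j ≤ k → IsCompactInL1
      {g : ℝ → X | ∃ x ∈ K, ∃ l : ℕ, l ≤ j ∧ g = fun r : ℝ =>
        r ^ (j - 1) • iteratedDeriv l (sphericalMean F x) r}) :
    FourierInversionUniformlyOn F K := by
  subst hn
  obtain ⟨d, hd⟩ := exists_fourierPartial_eq (X := X) hk
  obtain ⟨M, hM⟩ := hK.exists_bound_of_continuousOn hF_diff.continuous.continuousOn
  rw [FourierInversionUniformlyOn, Metric.tendstoUniformlyOn_iff]
  intro ε hε
  -- `D` collects the weights of the three kinds of error, each below `η`. The absolute value of `M`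
  -- covers an empty `K`, where the bound could be negative.
  set D : ℝ := 2 / Real.pi + |M| + ∑ j ∈ Finset.range k, |d j| with hD
  have hD0 : 0 ≤ D := by positivity
  set η : ℝ := ε / (D + 1) with hη
  have hη0 : 0 < η := by positivity
  have hdir : ∀ᶠ R : ℝ in atTop,
      |2 / Real.pi * (∫ r in Ioc 0 δ, Real.sin (R * r) * r⁻¹) - 1| < η := by
    have h := (tendsto_integral_sin_mul_inv hδ).const_mul (2 / Real.pi)
    rw [show 2 / Real.pi * (Real.pi / 2) = 1 by field_simp] at h
    exact (Metric.tendsto_nhds.1 h) η hη0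
  have hder : ∀ᶠ R : ℝ in atTop, ∀ j ∈ Finset.range k, ∀ g ∈ {g : ℝ → X | ∃ x ∈ K, ∃ l : ℕ,
      l ≤ j + 1 ∧ g = fun r : ℝ => r ^ (j + 1 - 1) • iteratedDeriv l (sphericalMean F x) r},
      ‖∫ r in Ioi (0 : ℝ), Real.sin (R * r) • g r‖ < η := by
    rw [Filter.eventually_all_finset]
    intro j hj
    rw [Finset.mem_range] at hj
    exact (hcomp_deriv (j + 1) (by omega) hj).eventually_norm_integral_sin_smul_lt hη0
  filter_upwards [eventually_ge_atTop (0 : ℝ), hdir, hder,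
    hcomp_zero.eventually_norm_integral_sin_smul_lt hη0] with R hR h1 h2 h3 x hx
  rw [dist_comm, dist_eq_norm, hd F hF_int hF_diff x δ R hR (hcomp_zero.1 _ ⟨x, hx, rfl⟩)
    fun j hj1 hjk l hl => (hcomp_deriv j hj1 hjk).1 _ ⟨x, hx, l, hl, rfl⟩]
  have h3' := h3 _ ⟨x, hx, rfl⟩
  set T : X := ∫ r in Ioi (0 : ℝ), Real.sin (R * r) •
    (r⁻¹ • (sphericalMean F x r - (Ioo 0 δ).indicator (fun _ => F x) r))
  set q : ℝ := 2 / Real.pi * ∫ r in Ioc 0 δ, Real.sin (R * r) * r⁻¹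
  set W : X := ∑ j ∈ Finset.range k, d j • ∫ r in Ioi (0 : ℝ),
    Real.sin (R * r) • (r ^ j • iteratedDeriv (j + 1) (sphericalMean F x) r)
  have hW : ‖W‖ ≤ (∑ j ∈ Finset.range k, |d j|) * η := by
    rw [Finset.sum_mul]
    refine (norm_sum_le _ _).trans (Finset.sum_le_sum fun j hj => ?_)
    rw [norm_smul, Real.norm_eq_abs]
    -- Only the top derivative of each level enters here; the lower ones serve the decay of boundary
    -- terms.
    have := h2 j hj _ ⟨x, hx, j + 1, le_rfl, rfl⟩
    rw [Nat.add_sub_cancel] at this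
    gcongr
  have hT : ‖(2 / Real.pi) • T‖ ≤ 2 / Real.pi * η := by
    rw [norm_smul, Real.norm_of_nonneg (by positivity)]
    gcongr
  have hq : ‖(q - 1) • F x‖ ≤ η * |M| := by
    rw [norm_smul]
    gcongr
    · exact h1.le
    · exact (hM x hx).trans (le_abs_self M)
  have hsplit : (2 / Real.pi) • T + q • F x + W - F x =
      (2 / Real.pi) • T + (q - 1) • F x + W := by
    rw [sub_smul, one_smul]
    abel
  rw [hsplit]
  calc _ ≤ 2 / Real.pi * η + η * |M| + (∑ j ∈ Finset.range k, |d j|) * η :=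
        (norm_add₃_le ..).trans (by gcongr)
    _ = D * η := by rw [hD]; ring
    _ < (D + 1) * η := by linarith
    _ = ε := by rw [hη]; field_simp
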